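/- Let $n\ge 1$ and let $w_1,\dots,w_n\in\mathbb{R}^n$ be linearly independent unit vectors. For vectors $v_1,\dots,v_n$ let $\mathfrak{c}(v_1,\dots,v_n)=\{\sum_i c_i v_i : c_i\ge 0\}$ be the cone they generate, let $[C]$ denote the indicator function of a cone $C$, and let $M_n(v_1,\dots,v_n)$ be the associated matrix, the $n\times n$ matrix with diagonal entries $1$ and $(i,j)$ entry $-|v_i\cdot v_j|$ for $i\ne j$. Then there are finitely many signs $s_1,\dots,s_N\in\{1,-1\}$ and cones $C_m=\mathfrak{c}(v^{(m)}_1,\dots,v^{(m)}_n)$, $1\le m\le N$, such that $$[\mathfrak{c}(w_1,\dots,w_n)]\equiv\sum_{m=1}^N s_m[C_m]$$ modulo indicator functions of lower-dimensional cones, that is, the difference of the two sides is a finite integer combination of indicator functions of polyhedral cones in $\mathbb{R}^n$ of dimension less than $n$ (a polyhedral cone being an intersection of finitely many closed half-spaces whose boundaries contain the origin), and such that for every $m$ the vectors $v_i=v^{(m)}_i$ are linearly independent (so $C_m$ is full-dimensional) and satisfy: (a) $\|v_i\|=1$ for $1\le i\le n$; (b) $v_n=w_n$; (c) $\langle v_1,\dots,v_{n-1}\rangle=\langle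 w_1,\dots,w_{n-1}\rangle$ (linear spans); (d) $v_i\cdot v_n=0$ for $1\le i\le n-2$; (e) there are $\epsilon_1,\dots,\epsilon_n\in\{1,-1\}$ such that $x^T M_n(v_1,\dots,v_n)\,x=\big\|\sum_{i=1}^n \epsilon_i x_i v_i\big\|^2$ for every $x\in\mathbb{R}^n$. In particular, the associated matrix $M_n(v_1,\dots,v_n)$ of each $C_m$ is positive definite. -/

import Mathlib

/-- Euclidean space `ℝᵈ` with its standard inner product. -/
abbrev RSpace (d : ℕ) : Type := EuclideanSpace ℝ (Fin d)

/-- The cone `𝔠(v₁, …, v_k)` generated by `v₁, …, v_k`: all linear combinations with nonnegative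
coefficients. -/
def genCone {d k : ℕ} (v : Fin k → RSpace d) : Set (RSpace d) :=
  (PointedCone.hull ℝ (Set.range v) : Set (RSpace d))

/-- A polyhedral cone: an intersection of finitely many half-spaces whose boundary passes through
the origin (the empty intersection is the whole space). -/
def IsPolyhedralCone {d : ℕ} (S : Set (RSpace d)) : Prop :=
  ∃ A : Finset (RSpace d), S = {x | ∀ a ∈ A, 0 ≤ inner ℝ a x}

/-- A lower-dimensional cone in `ℝᵈ`: a polyhedral cone whose dimension (that of its linear span,
which is also its affine hull, since a cone contains `0`) is less than `d`. -/
def IsLowerDimCone {d : ℕ} (S : Set (RSpace d)) : Prop :=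
  IsPolyhedralCone S ∧ Module.finrank ℝ (Submodule.span ℝ S) < d

/-- The indicator function `[S]`, with integer values. -/
noncomputable def ind {d : ℕ} (S : Set (RSpace d)) : RSpace d → ℤ :=
  S.indicator 1

/-- The group of finite integer combinations of indicator functions of lower-dimensional cones. -/
def lowerDimGroup (d : ℕ) : AddSubgroup (RSpace d → ℤ) :=
  AddSubgroup.closure {f | ∃ S : Set (RSpace d), IsLowerDimCone S ∧ f = ind S}

/-- Equality modulo indicator functions of lower-dimensional cones. -/
def EqModLowerDim {d : ℕ} (f g : RSpace d → ℤ) : Prop :=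
  f - g ∈ lowerDimGroup d

/-- The associated matrix: `1` on the diagonal and `-|vᵢ ⬝ vⱼ|` off the diagonal. -/
noncomputable def assocMatrix {d k : ℕ} (v : Fin k → RSpace d) : Matrix (Fin k) (Fin k) ℝ :=
  Matrix.of fun i j => if i = j then 1 else -|inner ℝ (v i) (v j)|

/-- The properties (a)–(e) of generators `v₁, …, v_{n+1}` of a cone in `ℝⁿ⁺¹`, relative to the
generators `w₁, …, w_{n+1}` of the decomposed cone. The dimension is written as `n + 1`, so the
last index is `Fin.last n` and the `n` other indices are the `Fin.castSucc i`. -/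
structure SpecialGenerators {n : ℕ} (w v : Fin (n + 1) → RSpace (n + 1)) : Prop where
  /-- (a) the generators are unit vectors -/
  norm_eq_one : ∀ i, ‖v i‖ = 1
  /-- (b) the last generator is kept -/
  last_eq : v (Fin.last n) = w (Fin.last n)
  /-- (c) all generators but the last span the same subspace as before -/
  span_eq : Submodule.span ℝ (Set.range fun i : Fin n => v i.castSucc) =
    Submodule.span ℝ (Set.range fun i : Fin n => w i.castSucc)
  /-- (d) all generators but the last two are orthogonal to the last one (the last two are those
  with indices `n - 1` and `n` when counting from `0`) -/
  orthogonal_last : ∀ i : Fin (n + 1), (i : ℕ) + 1 < n → inner ℝ (v i) (v (Fin.last n)) = 0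
  /-- (e) for suitable signs `εᵢ`, `xᵀ M x = ‖∑ εᵢ xᵢ vᵢ‖²` for all `x` -/
  quadForm_eq : ∃ ε : Fin (n + 1) → ℝ, (∀ i, ε i = 1 ∨ ε i = -1) ∧
    ∀ x : Fin (n + 1) → ℝ,
      dotProduct x ((assocMatrix v).mulVec x) = ‖∑ i, (ε i * x i) • v i‖ ^ 2

/-!
The cones of the decomposition have generators with tridiagonal Gram matrix, `vᵢ ⬝ vⱼ = 0` for
`|i - j| ≥ 2`. For such generators the signs `εᵢ` can be chosen one after another so that every
`εᵢ εⱼ (vᵢ ⬝ vⱼ)` with `i ≠ j` is nonpositive. Then `εᵢ εⱼ (vᵢ ⬝ vⱼ)` is the associated matrix, its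
quadratic form is `‖∑ εᵢ xᵢ vᵢ‖²`, and it is positive definite because the `vᵢ` are independent
(`exists_signs_mul_inner_eq_assocMatrix`, `assocMatrix_posDef`).

Such cones are reached by induction on the number of generators
(`ind_genCone_mem_tridiagonalFamilies`). Let `V` be the span of all generators but the last one,
`p`. The cone in `V` generated by them is first written, modulo facets, as a signed sum of
simplicial cones all but one of whose generators are orthogonal to `p`
(`ind_genCone_mem_castSucc_mem_ker`). This rests on a single move, `ind_genCone_split`: a vector
`u = vᵢ + t vⱼ` with `t > 0` cuts a simplicial cone into two, and if `vᵢ` and `vⱼ` are not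
orthogonal to `p` then some combination `u` of them is. Depending on the sign of the ratio of
`vᵢ ⬝ p` and `vⱼ ⬝ p`, either the cone of the `vᵢ` is cut by `u`, or the cone with `u` in place of
`vᵢ` is cut by `vᵢ`; in both cases the resulting cones have fewer generators not orthogonal to `p`.
The induction hypothesis for these cones keeps the span of the generators orthogonal to `p`, so that
`p` can be adjoined as the new last generator without spoiling the tridiagonal shape. Adjoining the
ray through `p` is additive on indicator functions (`adjoinRay`) and turns facets into facets, so
every error term in the end is a facet of an `n`-dimensional simplicial cone.

Generators need not be unit vectors in the induction; they are normalized at the end.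
-/

/-! ### Membership in simplicial cones and their facets -/

section Membership

variable {d k : ℕ}

theorem mem_genCone_iff {v : Fin k → RSpace d} {x : RSpace d} :
    x ∈ genCone v ↔ ∃ c : Fin k → ℝ, (∀ i, 0 ≤ c i) ∧ ∑ i, c i • v i = x := by
  unfold genCone PointedCone.hull
  rw [SetLike.mem_coe, Submodule.mem_span_range_iff_exists_fun]
  constructor
  · rintro ⟨c, hc⟩
    exact ⟨fun i => c i, fun i => (c i).2, hc⟩
  · rintro ⟨c, h0, hc⟩
    exact ⟨fun i => ⟨c i, h0 i⟩, hc⟩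

theorem genCone_subset_span (v : Fin k → RSpace d) :
    genCone v ⊆ Submodule.span ℝ (Set.range v) := by
  intro x hx
  obtain ⟨c, -, rfl⟩ := mem_genCone_iff.1 hx
  exact Submodule.sum_mem _ fun i _ => Submodule.smul_mem _ _ (Submodule.subset_span ⟨i, rfl⟩)

theorem genCone_comp_perm (v : Fin k → RSpace d) (σ : Equiv.Perm (Fin k)) :
    genCone (v ∘ σ) = genCone v := by
  unfold genCone
  rw [σ.surjective.range_comp]

theorem genCone_pos_smul (v : Fin k → RSpace d) {r : Fin k → ℝ} (hr : ∀ i, 0 < r i) :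
    genCone (fun i => r i • v i) = genCone v := by
  ext x
  simp only [mem_genCone_iff]
  constructor
  · rintro ⟨c, hc, rfl⟩
    exact ⟨fun i => c i * r i, fun i => mul_nonneg (hc i) (hr i).le, by simp only [mul_smul]⟩
  · rintro ⟨c, hc, rfl⟩
    refine ⟨fun i => c i / r i, fun i => div_nonneg (hc i) (hr i).le, ?_⟩
    simp only [smul_smul, div_mul_cancel₀ _ (hr _).ne']

theorem sum_smul_update (v : Fin k → RSpace d) (c : Fin k → ℝ) (i : Fin k) (x : RSpace d) :
    ∑ l, c l • Function.update v i x l = ∑ l, c l • v l + c i • (x - v i) := by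
  rw [← Finset.add_sum_erase _ _ (Finset.mem_univ i),
    ← Finset.add_sum_erase Finset.univ (fun l => c l • v l) (Finset.mem_univ i),
    Function.update_self, Finset.sum_congr rfl fun l hl => by
      rw [Function.update_of_ne (Finset.ne_of_mem_erase hl)]]
  module

theorem sum_update_smul (v : Fin k → RSpace d) (c : Fin k → ℝ) (i : Fin k) (r : ℝ) :
    ∑ l, Function.update c i r l • v l = ∑ l, c l • v l + (r - c i) • v i := by
  rw [← Finset.add_sum_erase _ _ (Finset.mem_univ i),
    ← Finset.add_sum_erase Finset.univ (fun l => c l • v l) (Finset.mem_univ i),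
    Function.update_self, Finset.sum_congr rfl fun l hl => by
      rw [Function.update_of_ne (Finset.ne_of_mem_erase hl)]]
  module

theorem sum_smul_mem_genCone_iff {v : Fin k → RSpace d} (hv : LinearIndependent ℝ v)
    (c : Fin k → ℝ) : ∑ i, c i • v i ∈ genCone v ↔ ∀ i, 0 ≤ c i := by
  rw [mem_genCone_iff]
  constructor
  · rintro ⟨c', h0, h⟩
    obtain rfl : c' = c :=
      hv.fintypeLinearCombination_injective (by simpa [Fintype.linearCombination_apply])
    exact h0
  · exact fun h => ⟨c, h, rfl⟩

/-- The facet of a simplicial cone opposite to its `j`-th ray, encoded by replacing the `j`-th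
generator by `0`, consists of the points of the cone whose `j`-th coordinate vanishes. -/
theorem sum_smul_mem_genCone_update_zero_iff {v : Fin k → RSpace d} (hv : LinearIndependent ℝ v)
    (c : Fin k → ℝ) (j : Fin k) :
    ∑ i, c i • v i ∈ genCone (Function.update v j 0) ↔ (∀ i, 0 ≤ c i) ∧ c j = 0 := by
  rw [mem_genCone_iff]
  constructor
  · rintro ⟨c', h0, h⟩
    have h' : ∑ l, Function.update c' j 0 l • v l = ∑ i, c i • v i := by
      rw [← h, sum_smul_update, sum_update_smul]
      module
    obtain rfl : Function.update c' j 0 = c :=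
      hv.fintypeLinearCombination_injective (by simpa [Fintype.linearCombination_apply])
    refine ⟨fun i => ?_, Function.update_self ..⟩
    rcases eq_or_ne i j with rfl | hij
    · simp
    · simpa [Function.update_of_ne hij] using h0 i
  · rintro ⟨h0, hj⟩
    exact ⟨c, h0, by rw [sum_smul_update, hj, zero_smul, add_zero]⟩

theorem genCone_update_zero_subset_span (v : Fin k → RSpace d) (j : Fin k) :
    genCone (Function.update v j 0) ⊆ Submodule.span ℝ (Set.range v) := by
  refine (genCone_subset_span _).trans (Submodule.span_le.2 ?_)
  rintro _ ⟨l, rfl⟩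
  rcases eq_or_ne l j with rfl | hl
  · simp
  · rw [Function.update_of_ne hl]
    exact Submodule.subset_span ⟨l, rfl⟩

theorem linearIndependent_update_add_smul {v : Fin k → RSpace d} (hv : LinearIndependent ℝ v)
    {i j : Fin k} {x : RSpace d} {s t : ℝ} (hij : i ≠ j) (hs : s ≠ 0)
    (hx : x = s • v i + t • v j) : LinearIndependent ℝ (Function.update v i x) := by
  rw [Fintype.linearIndependent_iff] at hv ⊢
  intro g hg
  -- in terms of `v`, the coefficients are `s * g i` at `i` and `g j + t * g i` at `j`
  have h := hv (Function.update (Function.update g j (g j + t * g i)) i (s * g i)) (by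
    rw [sum_update_smul, sum_update_smul, Function.update_of_ne hij, ← hg, sum_smul_update, hx]
    module)
  have hi : g i = 0 := by simpa [hs] using h i
  intro l
  rcases eq_or_ne l i with rfl | hl
  · exact hi
  · have := h l
    rw [Function.update_of_ne hl] at this
    rcases eq_or_ne l j with rfl | hl'
    · simpa [hi] using this
    · rwa [Function.update_of_ne hl'] at this

theorem update_mem_of_mem {v : Fin k → RSpace d} {V : Submodule ℝ (RSpace d)}
    (hv : ∀ l, v l ∈ V) {x : RSpace d} (hx : x ∈ V) (i l : Fin k) :
    Function.update v i x l ∈ V := by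
  rcases eq_or_ne l i with rfl | hl
  · simpa
  · simpa [Function.update_of_ne hl] using hv l

end Membership

/-! ### Splitting a simplicial cone along a two-dimensional face -/

section Splitting

variable {d k : ℕ}

open Classical in
theorem ind_apply (S : Set (RSpace d)) (x : RSpace d) : ind S x = if x ∈ S then 1 else 0 := by
  simp [ind, Set.indicator_apply]

theorem ind_of_notMem {S : Set (RSpace d)} {x : RSpace d} (h : x ∉ S) : ind S x = 0 := by
  simp [ind, h]

/-- A ray through `vᵢ + t vⱼ` with `t > 0` cuts a simplicial cone into two simplicial cones that
meet in a common facet. -/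
theorem ind_genCone_split {v : Fin k → RSpace d} (hv : LinearIndependent ℝ v) {i j : Fin k}
    (hij : i ≠ j) {t : ℝ} (ht : 0 < t) {u : RSpace d} (hu : u = v i + t • v j) :
    ind (genCone v) = ind (genCone (Function.update v i u)) +
      ind (genCone (Function.update v j u)) -
      ind (genCone (Function.update (Function.update v i u) j 0)) := by
  have hvi : LinearIndependent ℝ (Function.update v i u) :=
    linearIndependent_update_add_smul hv hij one_ne_zero (by rw [hu, one_smul])
  have hvj : LinearIndependent ℝ (Function.update v j u) :=
    linearIndependent_update_add_smul (t := 1) hv hij.symm ht.ne' (by rw [hu, one_smul, add_comm])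
  have hmem : ∀ l, v l ∈ Submodule.span ℝ (Set.range v) := fun l => Submodule.subset_span ⟨l, rfl⟩
  have hmu : u ∈ Submodule.span ℝ (Set.range v) := by
    rw [hu]
    exact add_mem (hmem i) (Submodule.smul_mem _ _ (hmem j))
  have hspan : ∀ l, Submodule.span ℝ (Set.range (Function.update v l u)) ≤
      Submodule.span ℝ (Set.range v) := by
    intro l
    rw [Submodule.span_le]
    rintro _ ⟨m, rfl⟩
    exact update_mem_of_mem hmem hmu l m
  ext y
  simp only [Pi.add_apply, Pi.sub_apply]
  by_cases hy : y ∈ Submodule.span ℝ (Set.range v)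
  · obtain ⟨c, hc⟩ := (Submodule.mem_span_range_iff_exists_fun ℝ).1 hy
    have hyi : ∑ l, Function.update c j (c j - t * c i) l • Function.update v i u l = y := by
      rw [sum_smul_update, sum_update_smul, Function.update_of_ne hij, hc, hu]
      module
    have hyj : ∑ l, Function.update (Function.update c i (c i - c j / t)) j (c j / t) l •
        Function.update v j u l = y := by
      have hb : c j = (c j / t) * t := by field_simp
      rw [sum_smul_update, sum_update_smul, sum_update_smul, Function.update_of_ne hij.symm, hc, hu,
        Function.update_self]
      generalize c j / t = b at hb ⊢
      rw [hb]
      module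
    have split : ∀ p : Fin k → Prop,
        (∀ l, p l) ↔ p i ∧ p j ∧ ∀ l, l ≠ i → l ≠ j → p l := fun p =>
      ⟨fun h => ⟨h i, h j, fun l _ _ => h l⟩, fun h l => by
        by_cases hi : l = i
        · exact hi ▸ h.1
        · by_cases hj : l = j
          · exact hj ▸ h.2.1
          · exact h.2.2 l hi hj⟩
    have hA : y ∈ genCone v ↔ 0 ≤ c i ∧ 0 ≤ c j ∧ ∀ l, l ≠ i → l ≠ j → 0 ≤ c l := by
      rw [← split (fun l => 0 ≤ c l), ← hc, sum_smul_mem_genCone_iff hv]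
    have hB' : (∀ l, 0 ≤ Function.update c j (c j - t * c i) l) ↔
        0 ≤ c i ∧ t * c i ≤ c j ∧ ∀ l, l ≠ i → l ≠ j → 0 ≤ c l := by
      rw [split, Function.update_of_ne hij, Function.update_self, sub_nonneg]
      refine and_congr_right fun _ => and_congr_right fun _ => forall_congr' fun l => ?_
      exact forall_congr' fun _ => forall_congr' fun h => by rw [Function.update_of_ne h]
    have hB : y ∈ genCone (Function.update v i u) ↔
        0 ≤ c i ∧ t * c i ≤ c j ∧ ∀ l, l ≠ i → l ≠ j → 0 ≤ c l := by
      rw [← hB']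
      nth_rw 1 [← hyi]
      rw [sum_smul_mem_genCone_iff hvi]
    have hC : y ∈ genCone (Function.update v j u) ↔
        c j ≤ t * c i ∧ 0 ≤ c j ∧ ∀ l, l ≠ i → l ≠ j → 0 ≤ c l := by
      nth_rw 1 [← hyj]
      rw [sum_smul_mem_genCone_iff hvj, split, Function.update_of_ne hij, Function.update_self,
        Function.update_self, sub_nonneg, div_le_iff₀' ht, le_div_iff₀ ht, zero_mul]
      refine and_congr_right fun _ => and_congr_right fun _ => forall_congr' fun l => ?_
      exact forall_congr' fun h => forall_congr' fun h' => by
        rw [Function.update_of_ne h', Function.update_of_ne h]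
    have hD : y ∈ genCone (Function.update (Function.update v i u) j 0) ↔
        (0 ≤ c i ∧ t * c i ≤ c j ∧ ∀ l, l ≠ i → l ≠ j → 0 ≤ c l) ∧ c j = t * c i := by
      rw [← hB']
      nth_rw 1 [← hyi]
      rw [sum_smul_mem_genCone_update_zero_iff hvi, Function.update_self, sub_eq_zero]
    by_cases hP : ∀ l, l ≠ i → l ≠ j → 0 ≤ c l
    · rw [and_iff_left hP] at hA hB hC hD
      simp only [ind_apply, hA, hB, hC, hD]
      have key : 0 ≤ c i → 0 ≤ t * c i := mul_nonneg ht.le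
      have key' : 0 ≤ t * c i → 0 ≤ c i := fun h => nonneg_of_mul_nonneg_right h ht
      generalize t * c i = b at *
      split_ifs <;> first | rfl | (exfalso; grind)
    · rw [ind_of_notMem fun h => hP (hA.1 h).2.2, ind_of_notMem fun h => hP (hB.1 h).2.2,
        ind_of_notMem fun h => hP (hC.1 h).2.2, ind_of_notMem fun h => hP (hD.1 h).1.2.2]
      rfl
  · rw [ind_of_notMem fun h => hy (genCone_subset_span _ h),
      ind_of_notMem fun h => hy (hspan i (genCone_subset_span _ h)),
      ind_of_notMem fun h => hy (hspan j (genCone_subset_span _ h)),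
      ind_of_notMem fun h => hy (hspan i (genCone_update_zero_subset_span _ _ h))]
    rfl

end Splitting

/-! ### Groups spanned by indicator functions of cones and of facets -/

section Groups

variable {d k : ℕ}

/-- The integer combinations of the indicator functions of the cones generated by the families
in `P`. -/
def coneGroup (P : Set (Fin k → RSpace d)) : AddSubgroup (RSpace d → ℤ) :=
  AddSubgroup.closure {f | ∃ v ∈ P, f = ind (genCone v)}

/-- The integer combinations of the indicator functions of the facets of `k`-dimensional simplicial
cones in `V`. The facet opposite to the `j`-th ray is encoded by replacing the `j`-th generator
by `0`. For `k = dim V = d` these are lower-dimensional cones. -/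
def facetGroup (k : ℕ) (V : Submodule ℝ (RSpace d)) : AddSubgroup (RSpace d → ℤ) :=
  AddSubgroup.closure {f | ∃ v : Fin k → RSpace d, LinearIndependent ℝ v ∧ (∀ i, v i ∈ V) ∧
    ∃ j, f = ind (genCone (Function.update v j 0))}

theorem ind_mem_coneGroup {P : Set (Fin k → RSpace d)} {v : Fin k → RSpace d} (hv : v ∈ P) :
    ind (genCone v) ∈ coneGroup P :=
  AddSubgroup.subset_closure ⟨v, hv, rfl⟩

theorem ind_mem_facetGroup {V : Submodule ℝ (RSpace d)} {v : Fin k → RSpace d}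
    (hv : LinearIndependent ℝ v) (hV : ∀ i, v i ∈ V) (j : Fin k) :
    ind (genCone (Function.update v j 0)) ∈ facetGroup k V :=
  AddSubgroup.subset_closure ⟨v, hv, hV, j, rfl⟩

theorem coneGroup_le {P : Set (Fin k → RSpace d)} {G : AddSubgroup (RSpace d → ℤ)}
    (h : ∀ v ∈ P, ind (genCone v) ∈ G) : coneGroup P ≤ G :=
  (AddSubgroup.closure_le G).2 (by rintro _ ⟨v, hv, rfl⟩; exact h v hv)

theorem facetGroup_le {V : Submodule ℝ (RSpace d)} {G : AddSubgroup (RSpace d → ℤ)}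
    (h : ∀ v : Fin k → RSpace d, LinearIndependent ℝ v → (∀ i, v i ∈ V) → ∀ j,
      ind (genCone (Function.update v j 0)) ∈ G) : facetGroup k V ≤ G :=
  (AddSubgroup.closure_le G).2 (by rintro _ ⟨v, hv, hV, j, rfl⟩; exact h v hv hV j)

end Groups

/-! ### Moving all generators but one into a hyperplane -/

section Hyperplane

variable {d k : ℕ}

/-- Two generators outside the hyperplane `a = 0` span a plane that meets the hyperplane in a line.
Splitting the cone along that line, or writing it as the difference of two cones when the line
lies outside the face of the two generators, leaves cones with fewer generators outside. -/
theorem ind_genCone_mem_subsingleton_support (a : Module.Dual ℝ (RSpace d))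
    (V : Submodule ℝ (RSpace d)) (m : ℕ) (v : Fin k → RSpace d) (hv : LinearIndependent ℝ v)
    (hV : ∀ i, v i ∈ V) (hm : (Finset.univ.filter fun i => a (v i) ≠ 0).card ≤ m) :
    ind (genCone v) ∈ coneGroup {v' : Fin k → RSpace d | LinearIndependent ℝ v' ∧
      (∀ i, v' i ∈ V) ∧ ∀ i j, a (v' i) ≠ 0 → a (v' j) ≠ 0 → i = j} ⊔ facetGroup k V := by
  induction m generalizing v with
  | zero =>
    refine AddSubgroup.mem_sup_left (ind_mem_coneGroup ⟨hv, hV, fun i j hi _ => ?_⟩)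
    simp only [nonpos_iff_eq_zero, Finset.card_eq_zero, Finset.filter_eq_empty_iff] at hm
    exact absurd hi (hm (Finset.mem_univ i))
  | succ m ih =>
    by_cases hdone : ∀ i j, a (v i) ≠ 0 → a (v j) ≠ 0 → i = j
    · exact AddSubgroup.mem_sup_left (ind_mem_coneGroup ⟨hv, hV, hdone⟩)
    push Not at hdone
    obtain ⟨i, j, hi, hj, hij⟩ := hdone
    have fewer : ∀ (v' : Fin k → RSpace d) (l : Fin k), a (v l) ≠ 0 → a (v' l) = 0 →
        (∀ l', a (v' l') ≠ 0 → a (v l') ≠ 0) →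
        (Finset.univ.filter fun i => a (v' i) ≠ 0).card ≤ m := by
      intro v' l hl hl' hsub
      refine Nat.lt_succ_iff.1 (lt_of_lt_of_le (Finset.card_lt_card ?_) hm)
      rw [Finset.ssubset_iff_of_subset fun x hx => by simpa using hsub x (by simpa using hx)]
      exact ⟨l, by simpa using hl, by simpa using hl'⟩
    have hupd : ∀ (x : RSpace d) (l : Fin k), a x = 0 →
        ∀ l', a (Function.update v l x l') ≠ 0 → a (v l') ≠ 0 := by
      intro x l hx l' h
      rcases eq_or_ne l' l with rfl | hl
      · simp [hx] at h
      · rwa [Function.update_of_ne hl] at h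
    obtain ⟨r, hr⟩ : ∃ r, a (v i) = r * a (v j) := ⟨a (v i) / a (v j), by field_simp⟩
    have hr0 : r ≠ 0 := by
      rintro rfl
      exact hi (by rw [hr, zero_mul])
    obtain ⟨u, hu⟩ : ∃ u, u = v i - r • v j := ⟨_, rfl⟩
    have hau : a u = 0 := by simp [hu, hr]
    have huV : u ∈ V := hu ▸ sub_mem (hV i) (V.smul_mem _ (hV j))
    have hvi : LinearIndependent ℝ (Function.update v i u) :=
      linearIndependent_update_add_smul (s := 1) (t := -r) hv hij one_ne_zero (by rw [hu]; module)
    have hViu := update_mem_of_mem hV huV i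
    have ih₁ := ih _ hvi hViu (fewer _ i hi (by simp [hau]) (hupd u i hau))
    have hface := AddSubgroup.mem_sup_right
      (S := coneGroup {v' : Fin k → RSpace d | LinearIndependent ℝ v' ∧
      (∀ i, v' i ∈ V) ∧ ∀ i j, a (v' i) ≠ 0 → a (v' j) ≠ 0 → i = j}) (ind_mem_facetGroup hvi hViu j)
    rcases lt_or_gt_of_ne hr0 with hneg | hpos
    · have hvj : LinearIndependent ℝ (Function.update v j u) :=
        linearIndependent_update_add_smul (s := -r) (t := 1) hv hij.symm (by simpa using hr0)
          (by rw [hu]; module)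
      have ih₂ := ih _ hvj (update_mem_of_mem hV huV j)
        (fewer _ j hj (by simp [hau]) (hupd u j hau))
      rw [ind_genCone_split hv hij (neg_pos.2 hneg) (u := u) (by rw [hu]; module)]
      exact sub_mem (add_mem ih₁ ih₂) hface
    · -- here `v i = u + r • v j`, so `v i` splits the cone with `u` in place of `v i`
      have hvij : LinearIndependent ℝ (Function.update (Function.update v i u) j (v i)) :=
        linearIndependent_update_add_smul (s := r) (t := 1) hvi hij.symm hr0
          (by rw [Function.update_of_ne hij.symm, Function.update_self, hu]; module)
      have ih₂ := ih _ hvij (update_mem_of_mem hViu (hV i) j)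
        (fewer _ i hi (by simp [Function.update_of_ne hij, hau]) (fun l h => by
          rcases eq_or_ne l j with rfl | hl
          · exact hj
          · rw [Function.update_of_ne hl] at h
            exact hupd u i hau l h))
      have hsplit := ind_genCone_split hvi hij hpos (u := v i)
        (by rw [Function.update_of_ne hij.symm, Function.update_self, hu]; module)
      rw [Function.update_idem, Function.update_eq_self] at hsplit
      have : ind (genCone v) = ind (genCone (Function.update v i u)) -
          ind (genCone (Function.update (Function.update v i u) j (v i))) +
          ind (genCone (Function.update v j 0)) := by
        rw [hsplit]; abel
      rw [this]
      exact add_mem (sub_mem ih₁ ih₂) (AddSubgroup.mem_sup_right (ind_mem_facetGroup hv hV j))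

theorem ind_genCone_mem_castSucc_mem_ker (a : Module.Dual ℝ (RSpace d))
    (V : Submodule ℝ (RSpace d)) (v : Fin (k + 1) → RSpace d) (hv : LinearIndependent ℝ v)
    (hV : ∀ i, v i ∈ V) :
    ind (genCone v) ∈ coneGroup {v' : Fin (k + 1) → RSpace d | LinearIndependent ℝ v' ∧
      (∀ i, v' i ∈ V) ∧ ∀ i : Fin k, a (v' i.castSucc) = 0} ⊔ facetGroup (k + 1) V := by
  refine sup_le_sup_right (coneGroup_le ?_) _
    (ind_genCone_mem_subsingleton_support a V _ v hv hV le_rfl)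
  rintro v' ⟨hv', hV', h⟩
  obtain ⟨i₀, hi₀⟩ : ∃ i₀, ∀ i, i ≠ i₀ → a (v' i) = 0 := by
    by_cases hex : ∃ i, a (v' i) ≠ 0
    · obtain ⟨i₀, h₀⟩ := hex
      exact ⟨i₀, fun i hi => by_contra fun hne => hi (h _ _ hne h₀)⟩
    · push Not at hex
      exact ⟨0, fun i _ => hex i⟩
  rw [← genCone_comp_perm v' (Equiv.swap i₀ (Fin.last k))]
  refine ind_mem_coneGroup ⟨hv'.comp _ (Equiv.injective _), fun i => hV' _, fun i => hi₀ _ ?_⟩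
  intro h
  rw [Equiv.swap_apply_eq_iff, Equiv.swap_apply_left] at h
  exact i.castSucc_lt_last.ne h

end Hyperplane

/-! ### Adjoining a generator -/

section Adjoin

variable {d k : ℕ}

/-- For `f w = 1`, the extension of functions on the hyperplane `f = 0` to functions on the
half-space `f ≥ 0` that are constant in the direction `w`, by zero on the other half-space. It sends
the indicator function of a cone in the hyperplane to that of its sum with the ray through `w`. -/
noncomputable def adjoinRay (f : Module.Dual ℝ (RSpace d)) (w : RSpace d) :
    (RSpace d → ℤ) →+ (RSpace d → ℤ) where
  toFun g y := if 0 ≤ f y then g (y - f y • w) else 0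
  map_zero' := by ext; simp
  map_add' g h := by ext y; by_cases hy : 0 ≤ f y <;> simp [hy]

theorem adjoinRay_ind_genCone {f : Module.Dual ℝ (RSpace d)} {w : RSpace d} (hw : f w = 1)
    {v : Fin k → RSpace d} (hv : ∀ i, f (v i) = 0) :
    adjoinRay f w (ind (genCone v)) = ind (genCone (Fin.snoc v w : Fin (k + 1) → RSpace d)) := by
  ext y
  have hy : y ∈ genCone (Fin.snoc v w : Fin (k + 1) → RSpace d) ↔
      0 ≤ f y ∧ y - f y • w ∈ genCone v := by
    rw [mem_genCone_iff, mem_genCone_iff]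
    constructor
    · rintro ⟨c, hc, rfl⟩
      have hf : f (∑ i, c i • (Fin.snoc v w : Fin (k + 1) → RSpace d) i) = c (Fin.last k) := by
        simp [Fin.sum_univ_castSucc, hv, hw]
      rw [hf]
      refine ⟨hc _, fun i => c i.castSucc, fun i => hc _, ?_⟩
      simp [Fin.sum_univ_castSucc]
    · rintro ⟨h0, c, hc, h⟩
      refine ⟨Fin.snoc c (f y), fun i => ?_, ?_⟩
      · refine Fin.lastCases ?_ (fun i => ?_) i
        · simpa using h0
        · simpa using hc i
      · simp [Fin.sum_univ_castSucc, h]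
  classical
  change (if 0 ≤ f y then ind (genCone v) (y - f y • w) else 0) = _
  rw [ind_apply, ind_apply]
  simp only [hy]
  split_ifs <;> simp_all

end Adjoin

/-! ### Decomposition into cones with tridiagonal Gram matrix -/

section Tridiagonal

variable {d k : ℕ}

/-- The linearly independent families `v` with tridiagonal Gram matrix that have the same last
member as `w` and whose other members lie in the span of the other members of `w`. -/
def tridiagonalFamilies (w : Fin (k + 1) → RSpace d) : Set (Fin (k + 1) → RSpace d) :=
  {v | LinearIndependent ℝ v ∧
    (∀ i : Fin k, v i.castSucc ∈ Submodule.span ℝ (Set.range fun i : Fin k => w i.castSucc)) ∧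
    v (Fin.last k) = w (Fin.last k) ∧ ∀ i j : Fin (k + 1), (i : ℕ) + 1 < j → inner ℝ (v i) (v j) = 0}

/-- The hyperplane used to modify the cone generated by all members of `w` but the last is the
orthogonal complement of the last one. -/
theorem ind_genCone_mem_tridiagonalFamilies (k : ℕ) (w : Fin (k + 1) → RSpace d)
    (hw : LinearIndependent ℝ w) :
    ind (genCone w) ∈ coneGroup (tridiagonalFamilies w) ⊔
      facetGroup (k + 1) (Submodule.span ℝ (Set.range w)) := by
  induction k with
  | zero =>
    refine AddSubgroup.mem_sup_left (ind_mem_coneGroup ⟨hw, fun i => i.elim0, rfl, fun i j h => ?_⟩)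
    omega
  | succ k ih =>
    set u : Fin (k + 1) → RSpace d := fun i => w i.castSucc with hu
    set p := w (Fin.last (k + 1)) with hp
    have hwu : (Fin.snoc u p : Fin (k + 2) → RSpace d) = w := Fin.snoc_init_self w
    obtain ⟨huLI, hpu⟩ := linearIndependent_finSnoc.1 (hwu.symm ▸ hw)
    set V := Submodule.span ℝ (Set.range u) with hVdef
    obtain ⟨f, hfp, hfV⟩ : ∃ f : Module.Dual ℝ (RSpace d), f p = 1 ∧ ∀ x ∈ V, f x = 0 := by
      obtain ⟨g, hg, hgV⟩ := Submodule.exists_le_ker_of_notMem hpu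
      exact ⟨(g p)⁻¹ • g, by simp [hg], fun x hx => by simp [LinearMap.mem_ker.1 (hgV hx)]⟩
    have hVw : V ≤ Submodule.span ℝ (Set.range w) :=
      Submodule.span_mono (by rintro _ ⟨i, rfl⟩; exact ⟨i.castSucc, rfl⟩)
    have hpw : p ∈ Submodule.span ℝ (Set.range w) := Submodule.subset_span ⟨_, rfl⟩
    have hsnoc : ∀ v : Fin (k + 1) → RSpace d, LinearIndependent ℝ v → (∀ i, v i ∈ V) →
        LinearIndependent ℝ (Fin.snoc v p : Fin (k + 2) → RSpace d) := fun v hv hvV =>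
      linearIndependent_finSnoc.2 ⟨hv, fun h => hpu
        (Submodule.span_le.2 (by rintro _ ⟨i, rfl⟩; exact hvV i) h)⟩
    -- the decomposition of the cone generated by `u`, with all rays but one orthogonal to `p`
    have hdec : ind (genCone u) ∈ coneGroup {v : Fin (k + 1) → RSpace d | LinearIndependent ℝ v ∧
        (∀ i, v i ∈ V) ∧ (∀ i : Fin k, inner ℝ (v i.castSucc) p = 0) ∧
        ∀ i j : Fin (k + 1), (i : ℕ) + 1 < j → inner ℝ (v i) (v j) = 0} ⊔ facetGroup (k + 1) V := by
      have h := ind_genCone_mem_castSucc_mem_ker (innerₛₗ ℝ p) V u huLI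
        fun i => Submodule.subset_span ⟨i, rfl⟩
      refine (sup_le (coneGroup_le ?_) le_sup_right :
        _ ≤ _ ⊔ facetGroup (k + 1) V) h
      rintro v' ⟨hv', hV', hav'⟩
      have hspan : Submodule.span ℝ (Set.range v') ≤ V :=
        Submodule.span_le.2 (by rintro _ ⟨i, rfl⟩; exact hV' i)
      refine sup_le_sup (coneGroup_le ?_) (facetGroup_le ?_) (ih v' hv')
      · rintro v ⟨hv, hcast, hlast, htri⟩
        refine ind_mem_coneGroup ⟨hv, fun i => ?_, fun i => ?_, htri⟩
        · refine Fin.lastCases ?_ (fun i => ?_) i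
          · rw [hlast]; exact hV' _
          · refine Submodule.span_le.2 ?_ (hcast i)
            rintro _ ⟨i, rfl⟩
            exact hV' _
        · have : Submodule.span ℝ (Set.range fun i : Fin k => v' i.castSucc) ≤
              LinearMap.ker (innerₛₗ ℝ p) :=
            Submodule.span_le.2 (by rintro _ ⟨i, rfl⟩; exact hav' i)
          rw [real_inner_comm]
          exact this (hcast i)
      · exact fun v hv hv' j => ind_mem_facetGroup hv (fun i => hspan (hv' i)) j
    have hT : ind (genCone w) = adjoinRay f p (ind (genCone u)) := by
      rw [adjoinRay_ind_genCone hfp fun i => hfV _ (Submodule.subset_span ⟨i, rfl⟩), hwu]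
    rw [hT, ← AddSubgroup.mem_comap]
    refine (sup_le (coneGroup_le ?_) (facetGroup_le ?_) : _ ⊔ facetGroup (k + 1) V ≤ _) hdec
    · rintro v ⟨hv, hvV, hvp, htri⟩
      rw [AddSubgroup.mem_comap, adjoinRay_ind_genCone hfp fun i => hfV _ (hvV i)]
      refine AddSubgroup.mem_sup_left (ind_mem_coneGroup
        ⟨hsnoc v hv hvV, fun i => ?_, by simp [hp], fun i j hij => ?_⟩)
      · rw [Fin.snoc_castSucc]; exact hvV i
      · induction j using Fin.lastCases with
        | last =>
          obtain ⟨i, rfl⟩ : ∃ i' : Fin k, i = i'.castSucc.castSucc :=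
            ⟨⟨i, by simp at hij; omega⟩, rfl⟩
          rw [Fin.snoc_castSucc, Fin.snoc_last]
          exact hvp i
        | cast j =>
          obtain ⟨i, rfl⟩ : ∃ i' : Fin (k + 1), i = i'.castSucc :=
            ⟨⟨i, by have := j.2; simp at hij; omega⟩, rfl⟩
          rw [Fin.snoc_castSucc, Fin.snoc_castSucc]
          exact htri i j (by simpa using hij)
    · intro v hv hvV j
      rw [AddSubgroup.mem_comap, adjoinRay_ind_genCone hfp fun i =>
        hfV _ (update_mem_of_mem hvV (zero_mem V) j i), Fin.snoc_update]
      refine AddSubgroup.mem_sup_right (ind_mem_facetGroup (hsnoc v hv hvV) (fun i => ?_) _)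
      refine Fin.lastCases ?_ (fun i => ?_) i
      · rw [Fin.snoc_last]; exact hpw
      · rw [Fin.snoc_castSucc]; exact hVw (hvV i)

end Tridiagonal

/-! ### Facets of full-dimensional simplicial cones -/

section LowerDim

variable {n : ℕ}

theorem isLowerDimCone_genCone_update_zero {v : Fin n → RSpace n} (hv : LinearIndependent ℝ v)
    (j : Fin n) : IsLowerDimCone (genCone (Function.update v j 0)) := by
  classical
  have : Nonempty (Fin n) := ⟨j⟩
  let b := basisOfLinearIndependentOfCardEqFinrank hv (by simp)
  have hb : ∀ x, ∑ i, b.repr x i • v i = x := fun x => by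
    simpa [b] using b.sum_repr x
  have hmem : ∀ x, x ∈ genCone (Function.update v j 0) ↔
      (∀ i, 0 ≤ b.repr x i) ∧ b.repr x j = 0 := fun x => by
    rw [← sum_smul_mem_genCone_update_zero_iff hv, hb]
  let a : Fin n → RSpace n := fun i =>
    (InnerProductSpace.toDual ℝ (RSpace n)).symm (LinearMap.toContinuousLinearMap (b.coord i))
  have ha : ∀ i x, inner ℝ (a i) x = b.repr x i := fun i x => by simp [a]
  refine ⟨⟨insert (-a j) (Finset.univ.image a), ?_⟩, ?_⟩
  · ext x
    rw [hmem]
    simp only [Finset.mem_insert, Finset.mem_image, Finset.mem_univ, true_and, Set.mem_ofPred_eq,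
      forall_eq_or_imp, forall_exists_index, forall_apply_eq_imp_iff, inner_neg_left, ha]
    constructor
    · exact fun h => ⟨by rw [h.2, neg_zero], h.1⟩
    · exact fun h => ⟨h.2, le_antisymm (neg_nonneg.1 h.1) (h.2 j)⟩
  · have hle : Submodule.span ℝ (genCone (Function.update v j 0)) ≤ LinearMap.ker (b.coord j) :=
      Submodule.span_le.2 fun x hx => ((hmem x).1 hx).2
    have hlt : Submodule.span ℝ (genCone (Function.update v j 0)) < ⊤ := by
      refine lt_top_iff_ne_top.2 fun h => ?_
      have : b j ∈ LinearMap.ker (b.coord j) := hle (h ▸ Submodule.mem_top)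
      simp at this
    simpa using Submodule.finrank_lt hlt.ne

theorem facetGroup_le_lowerDimGroup (n : ℕ) (V : Submodule ℝ (RSpace n)) :
    facetGroup n V ≤ lowerDimGroup n :=
  facetGroup_le fun _ hv _ j =>
    AddSubgroup.subset_closure ⟨_, isLowerDimCone_genCone_update_zero hv j, rfl⟩

end LowerDim

/-! ### Signed sums -/

theorem exists_signed_sum_of_mem_coneGroup {d k : ℕ} {P : Set (Fin k → RSpace d)}
    {f : RSpace d → ℤ} (hf : f ∈ coneGroup P) :
    ∃ (N : ℕ) (s : Fin N → ℤ) (v : Fin N → Fin k → RSpace d),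
      (∀ m, s m = 1 ∨ s m = -1) ∧ (∀ m, v m ∈ P) ∧ f = ∑ m, s m • ind (genCone (v m)) := by
  unfold coneGroup at hf
  induction hf using AddSubgroup.closure_induction with
  | mem f hf =>
    obtain ⟨v, hv, rfl⟩ := hf
    exact ⟨1, fun _ => 1, fun _ => v, fun _ => Or.inl rfl, fun _ => hv, by simp⟩
  | zero => exact ⟨0, Fin.elim0, Fin.elim0, fun m => m.elim0, fun m => m.elim0, by simp⟩
  | add f g _ _ hf hg =>
    obtain ⟨N, s, v, hs, hv, rfl⟩ := hf
    obtain ⟨N', s', v', hs', hv', rfl⟩ := hg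
    refine ⟨N + N', Fin.append s s', Fin.append v v', fun m => ?_, fun m => ?_, ?_⟩
    · refine Fin.addCases (fun i => ?_) (fun i => ?_) m
      · simpa using hs i
      · simpa using hs' i
    · refine Fin.addCases (fun i => ?_) (fun i => ?_) m
      · simpa using hv i
      · simpa using hv' i
    · simp [Fin.sum_univ_add]
  | neg f _ hf =>
    obtain ⟨N, s, v, hs, hv, rfl⟩ := hf
    refine ⟨N, -s, v, fun m => ?_, hv, by simp⟩
    rcases hs m with h | h <;> simp [h]

/-! ### The associated matrix of a family with tridiagonal Gram matrix -/

section AssocMatrix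

variable {d n : ℕ}

/-- Since the graph of nonzero off-diagonal entries lies in a path, signs can be chosen one after
another so that they turn every off-diagonal entry of the Gram matrix nonpositive. -/
theorem exists_signs_mul_inner_eq_assocMatrix {v : Fin (n + 1) → RSpace d}
    (hunit : ∀ i, ‖v i‖ = 1)
    (htri : ∀ i j : Fin (n + 1), (i : ℕ) + 1 < j → inner ℝ (v i) (v j) = 0) :
    ∃ ε : Fin (n + 1) → ℝ, (∀ i, ε i = 1 ∨ ε i = -1) ∧
      ∀ i j, assocMatrix v i j = ε i * ε j * inner ℝ (v i) (v j) := by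
  obtain ⟨ε, h0, hε⟩ : ∃ ε : ℕ → ℝ, ε 0 = 1 ∧ ∀ l, ε (l + 1) =
      if 0 ≤ inner ℝ (v (Fin.ofNat (n + 1) l)) (v (Fin.ofNat (n + 1) (l + 1)))
        then -ε l else ε l :=
    ⟨fun l => Nat.rec 1 (fun l e =>
      if 0 ≤ inner ℝ (v (Fin.ofNat (n + 1) l)) (v (Fin.ofNat (n + 1) (l + 1)))
        then -e else e) l, rfl, fun _ => rfl⟩
  have hsign : ∀ l, ε l = 1 ∨ ε l = -1 := by
    intro l
    induction l with
    | zero => exact Or.inl h0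
    | succ l ih =>
      rw [hε]
      split_ifs <;> rcases ih with h | h <;> simp [h]
  have hsq : ∀ l, ε l * ε l = 1 := fun l => by rcases hsign l with h | h <;> simp [h]
  have hlt : ∀ i j : Fin (n + 1), i < j →
      -|inner ℝ (v i) (v j)| = ε i * ε j * inner ℝ (v i) (v j) := by
    intro i j hij
    rcases Nat.lt_or_ge ((i : ℕ) + 1) j with h | h
    · simp [htri i j h]
    · have hj : (j : ℕ) = i + 1 := le_antisymm h hij
      have e₁ : Fin.ofNat (n + 1) (i : ℕ) = i := Fin.ext (Nat.mod_eq_of_lt i.2)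
      have e₂ : Fin.ofNat (n + 1) ((i : ℕ) + 1) = j :=
        Fin.ext ((Nat.mod_eq_of_lt (hj ▸ j.2)).trans hj.symm)
      rw [hj, hε, e₁, e₂]
      split_ifs with hs
      · rw [abs_of_nonneg hs, mul_neg, hsq, neg_one_mul]
      · rw [abs_of_neg (not_le.1 hs), hsq, neg_neg, one_mul]
  refine ⟨fun i => ε i, fun i => hsign i, fun i j => ?_⟩
  rw [assocMatrix, Matrix.of_apply]
  rcases lt_trichotomy i j with h | rfl | h
  · rw [if_neg h.ne, hlt i j h]
  · simp [hsq, hunit]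
  · rw [if_neg h.ne', real_inner_comm, hlt j i h, mul_comm (ε j)]

theorem dotProduct_assocMatrix_mulVec {v : Fin n → RSpace d} {ε : Fin n → ℝ}
    (h : ∀ i j, assocMatrix v i j = ε i * ε j * inner ℝ (v i) (v j)) (x : Fin n → ℝ) :
    dotProduct x ((assocMatrix v).mulVec x) = ‖∑ i, (ε i * x i) • v i‖ ^ 2 := by
  rw [← real_inner_self_eq_norm_sq, sum_inner]
  simp only [inner_sum, dotProduct, Matrix.mulVec, h, Finset.mul_sum, inner_smul_left,
    inner_smul_right, conj_trivial]
  exact Finset.sum_congr rfl fun i _ => Finset.sum_congr rfl fun j _ => by ring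

theorem assocMatrix_posDef {v : Fin n → RSpace d} (hv : LinearIndependent ℝ v) {ε : Fin n → ℝ}
    (hε : ∀ i, ε i = 1 ∨ ε i = -1)
    (h : ∀ x : Fin n → ℝ, dotProduct x ((assocMatrix v).mulVec x) = ‖∑ i, (ε i * x i) • v i‖ ^ 2) :
    (assocMatrix v).PosDef := by
  refine Matrix.PosDef.of_dotProduct_mulVec_pos ?_ fun x hx => ?_
  · ext i j
    simp [assocMatrix, real_inner_comm, eq_comm]
  · rw [star_trivial, h]
    refine pow_pos (norm_pos_iff.2 fun h0 => hx (funext fun i => ?_)) 2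
    have := Fintype.linearIndependent_iff.1 hv _ h0 i
    rcases hε i with h | h <;> simpa [h] using this

end AssocMatrix

/-! ### The decomposition -/

theorem specialGenerators_normalize {n : ℕ} {w v : Fin (n + 1) → RSpace (n + 1)}
    (hw : LinearIndependent ℝ w) (hunit : ‖w (Fin.last n)‖ = 1) (hv : v ∈ tridiagonalFamilies w) :
    LinearIndependent ℝ (fun i => ‖v i‖⁻¹ • v i) ∧
      SpecialGenerators w (fun i => ‖v i‖⁻¹ • v i) ∧
      (assocMatrix fun i => ‖v i‖⁻¹ • v i).PosDef := by
  obtain ⟨hLI, hcast, hlast, htri⟩ := hv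
  have hne : ∀ i, ‖v i‖ ≠ 0 := fun i => norm_ne_zero_iff.2 (hLI.ne_zero i)
  have hLI' : LinearIndependent ℝ (fun i => ‖v i‖⁻¹ • v i) :=
    hLI.units_smul fun i => Units.mk0 ‖v i‖⁻¹ (inv_ne_zero (hne i))
  have hunit' : ∀ i, ‖‖v i‖⁻¹ • v i‖ = 1 := fun i => norm_smul_inv_norm (𝕜 := ℝ) (hLI.ne_zero i)
  have htri' : ∀ i j : Fin (n + 1), (i : ℕ) + 1 < j →
      inner ℝ (‖v i‖⁻¹ • v i) (‖v j‖⁻¹ • v j) = 0 := fun i j hij => by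
    rw [inner_smul_left, inner_smul_right, htri i j hij, mul_zero, mul_zero]
  obtain ⟨ε, hε, hM⟩ := exists_signs_mul_inner_eq_assocMatrix hunit' htri'
  have hq := dotProduct_assocMatrix_mulVec hM
  refine ⟨hLI', ⟨hunit', ?_, ?_, fun i hi => htri' i _ (by simpa using hi), ε, hε, hq⟩,
    assocMatrix_posDef hLI' hε hq⟩
  · simp only [hlast, hunit, inv_one, one_smul]
  · -- one span contains the other, and both have dimension `n`
    refine Submodule.eq_of_le_of_finrank_eq (Submodule.span_le.2 ?_) ?_
    · rintro _ ⟨i, rfl⟩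
      exact Submodule.smul_mem _ _ (hcast i)
    · exact (finrank_span_eq_card (hLI'.comp _ (Fin.castSucc_injective n))).trans
        (finrank_span_eq_card (hw.comp _ (Fin.castSucc_injective n))).symm

theorem theorem3p3 (n : ℕ) (w : Fin (n + 1) → RSpace (n + 1))
    (hw : LinearIndependent ℝ w) (hunit : ∀ i, ‖w i‖ = 1) :
    ∃ (N : ℕ) (s : Fin N → ℤ) (v : Fin N → Fin (n + 1) → RSpace (n + 1)),
      (∀ m, s m = 1 ∨ s m = -1) ∧
      (∀ m, LinearIndependent ℝ (v m) ∧ SpecialGenerators w (v m) ∧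
        (assocMatrix (v m)).PosDef) ∧
      EqModLowerDim (ind (genCone w)) (∑ m, s m • ind (genCone (v m))) := by
  obtain ⟨f, hf, g, hg, hfg⟩ :=
    AddSubgroup.mem_sup.1 (ind_genCone_mem_tridiagonalFamilies n w hw)
  obtain ⟨N, s, v, hs, hv, rfl⟩ := exists_signed_sum_of_mem_coneGroup hf
  refine ⟨N, s, fun m i => ‖v m i‖⁻¹ • v m i, hs,
    fun m => specialGenerators_normalize hw (hunit _) (hv m), ?_⟩
  have hcone : ∀ m, genCone (fun i => ‖v m i‖⁻¹ • v m i) = genCone (v m) := fun m =>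
    genCone_pos_smul _ fun i => inv_pos.2 (norm_pos_iff.2 ((hv m).1.ne_zero i))
  simp only [EqModLowerDim, hcone, ← hfg, add_sub_cancel_left]
  exact facetGroup_le_lowerDimGroup _ _ hg
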